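/- Let $\mathbb F$ be a field. For a matrix $A\in\mathbb F^{d\times d}$ and a real number $r\ge 0$, let $R^{rc}_{\mathbb F}(A,r)$ be the least integer $t\ge 0$ for which there is $Z\in\mathbb F^{d\times d}$ such that $\operatorname{rank}(A-Z)\le r$ and every row and every column of $Z$ has at most $t$ non-zero entries. Let $\log$ denote the binary logarithm throughout, or the natural logarithm throughout; the statement holds for both. Let $0<\varepsilon<1/2$ and $b\ge 2$ be real numbers. There is an integer $N=N(b,\varepsilon)$, depending only on $b$ and $\varepsilon$, such that the following holds for every field $\mathbb F$. Let $\mathcal F$ be a family of square matrices over $\mathbb F$ such that for every $d\times d$ matrix $A\in\mathcal F$ either $d\le b$, or $$R^{rc}_{\mathbb F}\bigl(A,\,d^{\,1-\gamma}\bigr)\le d^{\,\varepsilon}\qquad\text{for}\qquad \gamma=\frac{12(\log\log d)^2}{\varepsilon^3\log d}.$$ Then for every finite sequence of matrices $M_1,\dots,M_k\in\mathcal F$, the Kronecker product $M=M_1\otimes\cdots\otimes M_k$, an $n\times n$ matrix, satisfies $$R^{rc}_{\mathbb F}\bigl(M,\,n/\log n\bigr)\le n^{6\varepsilon}\qquad\text{or}\qquad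 n\le N.$$ -/

import Mathlib

/-- `Z` is an admissible change for `A` with target rank `r` and sparsity `t`: after subtracting it
the rank is at most `r`, and each row and each column of it has at most `t` non-zero entries. -/
def IsSparseReduction {F ι : Type*} [Field F] [Fintype ι] (A : Matrix ι ι F) (r : ℝ) (t : ℕ)
    (Z : Matrix ι ι F) : Prop :=
  ((A - Z).rank : ℝ) ≤ r ∧
    (∀ i, {j | Z i j ≠ 0}.ncard ≤ t) ∧ (∀ j, {i | Z i j ≠ 0}.ncard ≤ t)

/-- Row-column rigidity of a square matrix `A` over the field `F`: the least `t` such that some `Z`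
over the same field has at most `t` non-zero entries in every row and column, and
`rank (A - Z) ≤ r`. The target rank `r` may be any non-negative real number. -/
noncomputable def rcRigidity {F ι : Type*} [Field F] [Fintype ι] (A : Matrix ι ι F) (r : ℝ) : ℕ :=
  sInf {t : ℕ | ∃ Z : Matrix ι ι F, IsSparseReduction A r t Z}

/-- For non-negative target rank the minimum in the definition is over a non-empty set. -/
theorem rcRigidity_le_iff {F ι : Type*} [Field F] [Fintype ι] (A : Matrix ι ι F) {r : ℝ}
    (hr : 0 ≤ r) (t : ℕ) :
    rcRigidity A r ≤ t ↔ ∃ Z : Matrix ι ι F, IsSparseReduction A r t Z := by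
  have hne : {t : ℕ | ∃ Z : Matrix ι ι F, IsSparseReduction A r t Z}.Nonempty := by
    refine ⟨Fintype.card ι, A, by simpa using hr, fun i => ?_, fun j => ?_⟩ <;>
    · rw [← Nat.card_eq_fintype_card]
      exact Set.ncard_le_card _
  constructor
  · intro h
    obtain ⟨Z, h1, h2, h3⟩ := Nat.sInf_mem hne
    exact ⟨Z, h1, fun i => (h2 i).trans h, fun j => (h3 j).trans h⟩
  · intro h
    exact Nat.sInf_le h

/-- The Kronecker product `M₁ ⊗ ⋯ ⊗ M_k` of a finite sequence of square matrices of orders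
`d₁, …, d_k`. Its rows and columns are indexed by the tuples in `[d₁] × ⋯ × [d_k]`. -/
def kroneckerProd {F : Type*} [Field F] {k : ℕ} {d : Fin k → ℕ}
    (M : ∀ i, Matrix (Fin (d i)) (Fin (d i)) F) :
    Matrix (∀ i, Fin (d i)) (∀ i, Fin (d i)) F :=
  Matrix.of fun x y => ∏ i, M i (x i) (y i)

/-- The exponent `12 (log log d)² / (ε³ log d)`, where `log` is the logarithm to the base `β`. -/
noncomputable def rigidityGap (β ε : ℝ) (d : ℕ) : ℝ :=
  12 * (Real.logb β (Real.logb β d)) ^ 2 / (ε ^ 3 * Real.logb β d)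

/-- A family of square matrices over `F` (`𝓕 d` consists of its `d × d` members) in which each
matrix of order `d` has `d ≤ b`, or has row-column rigidity at most `d ^ ε` for the target rank
`d ^ (1 - γ)`, where `γ = 12 (log log d)² / (ε³ log d)`. -/
def IsBoundedOrNonRigid {F : Type*} [Field F] (β ε b : ℝ)
    (𝓕 : ∀ d : ℕ, Set (Matrix (Fin d) (Fin d) F)) : Prop :=
  ∀ (d : ℕ), ∀ A ∈ 𝓕 d,
    (d : ℝ) ≤ b ∨
      (rcRigidity A ((d : ℝ) ^ (1 - rigidityGap β ε d)) : ℝ) ≤ (d : ℝ) ^ ε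

open Filter

universe u

/-! Split the factors at a constant order `D` and write `Λ` for the logarithm of the size of a part.
Each part is changed so that its rank drops to its size over `2 log n`; the Kronecker product of the
two changes then leaves rank at most `n / log n`, and the sparsities `n^(2ε)` and `n^(3ε)` multiply.

Large factors (`NonRigid.piKron_of_small_rank`): write each factor as (low rank) + (sparse) and
expand the product over the set `S` of coordinates taking the low-rank summand. The terms with `S`
of weight `∑ log d i` at most `εΛ` add up to a sparse matrix. After row operations in each
coordinate, the other terms live on rows with unusually many coordinates in small sets, and a
Chernoff bound counts these. The gain depends on the gap `γ`, whose `(log log d)²` is what beats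
`log n`.

Bounded factors (`NonRigid.piKron_of_bounded`): no hypothesis is needed. By row-permuted LU
decomposition it suffices to treat products of triangular matrices. There a non-zero entry `(x, y)`
has `x ≤ y` coordinatewise. Apart from few rows of small and few columns of large coordinate sum,
both sums are near the mean, so `x` and `y` differ in few coordinates. The rank falls by a power of
the size.

A part of size at most `n^ε` is simply removed entirely. -/

/-- Some admissible change reduces the rank of `A` to at most `r` with sparsity `t`. -/
def NonRigid {F ι : Type*} [Field F] [Fintype ι] (A : Matrix ι ι F) (r : ℝ) (t : ℕ) : Prop :=
  ∃ Z : Matrix ι ι F, IsSparseReduction A r t Z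

/-! ### Rank bounds and row reduction -/

theorem Matrix.rank_add_le {F m n : Type*} [Field F] [Fintype m] [Fintype n]
    (A B : Matrix m n F) : (A + B).rank ≤ A.rank + B.rank := by
  classical
  rw [Matrix.rank, Matrix.rank, Matrix.rank, Matrix.mulVecLin_add]
  exact (Submodule.finrank_mono (LinearMap.range_add_le _ _)).trans
    (Submodule.finrank_add_le_finrank_add_finrank _ _)

/-- A matrix whose non-zero rows all lie in `X` has rank at most `#X`. -/
theorem Matrix.rank_le_card_of_row_support {F m n : Type*} [Field F] [Fintype m] [Fintype n]
    (A : Matrix m n F) (X : Finset m) (h : ∀ i ∉ X, ∀ j, A i j = 0) : A.rank ≤ X.card := by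
  classical
  have hA : A = Matrix.diagonal (fun i => if i ∈ X then (1 : F) else 0) * A := by
    ext i j
    rw [Matrix.diagonal_mul]
    by_cases hi : i ∈ X
    · simp [hi]
    · simp [hi, h i hi j]
  rw [hA]
  refine (Matrix.rank_mul_le_left _ _).trans ?_
  rw [Matrix.rank_diagonal, Fintype.card_subtype]
  apply Finset.card_le_card
  intro i
  simp

theorem Matrix.rank_le_card_of_col_support {F m n : Type*} [Field F] [Fintype m] [Fintype n]
    (A : Matrix m n F) (X : Finset n) (h : ∀ j ∉ X, ∀ i, A i j = 0) : A.rank ≤ X.card := by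
  rw [← Matrix.rank_transpose]
  exact Matrix.rank_le_card_of_row_support _ X fun j hj i => h j hj i

/-- Row operations make all but `rank L` rows of `L` vanish. -/
theorem Matrix.exists_row_reduction {F m : Type*} [Field F] [Fintype m] [DecidableEq m]
    (L : Matrix m m F) : ∃ (P Q : Matrix m m F) (R : Finset m), Q * P = 1 ∧
      R.card = L.rank ∧ ∀ i ∉ R, ∀ j, (P * L) i j = 0 := by
  classical
  obtain ⟨l, l', D, h⟩ := Matrix.Pivot.exists_list_transvec_mul_diagonal_mul_list_transvec L
  have hl (l : List (Matrix.TransvectionStruct m F)) :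
      IsUnit (l.map Matrix.TransvectionStruct.toMatrix).prod.det := by
    rw [Matrix.TransvectionStruct.det_toMatrix_prod]
    exact isUnit_one
  set E := (l.map Matrix.TransvectionStruct.toMatrix).prod
  set E' := (l'.map Matrix.TransvectionStruct.toMatrix).prod
  -- From `L = E * diagonal D * E'`, undoing `E` leaves the rows of `E'` scaled by `D`.
  refine ⟨E⁻¹, E, Finset.univ.filter fun i => D i ≠ 0, Matrix.mul_nonsing_inv _ (hl l), ?_, ?_⟩
  · rw [h, Matrix.rank_mul_eq_left_of_isUnit_det _ _ (hl l'),
      Matrix.rank_mul_eq_right_of_isUnit_det _ _ (hl l), Matrix.rank_diagonal,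
      Fintype.card_subtype]
  · intro i hi j
    have hi' : D i = 0 := by simpa using hi
    have : E⁻¹ * L = Matrix.diagonal D * E' := by
      rw [h, Matrix.mul_assoc E, Matrix.nonsing_inv_mul_cancel_left _ _ (hl l)]
    rw [this, Matrix.diagonal_mul, hi', zero_mul]

/-! ### Stability of non-rigidity under products -/

namespace NonRigid

variable {F : Type*} [Field F] {α β : Type*} [Fintype α] [Fintype β]

theorem mono {A : Matrix α α F} {r r' : ℝ} {t t' : ℕ} (h : NonRigid A r t) (hr : r ≤ r')
    (ht : t ≤ t') : NonRigid A r' t' := by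
  obtain ⟨Z, h1, h2, h3⟩ := h
  exact ⟨Z, h1.trans hr, fun i => (h2 i).trans ht, fun j => (h3 j).trans ht⟩

theorem dense (A : Matrix α α F) : NonRigid A 0 (Fintype.card α) := by
  refine ⟨A, by simp, fun i => ?_, fun j => ?_⟩ <;>
  · rw [← Nat.card_eq_fintype_card]
    exact Set.ncard_le_card _

theorem transpose {A : Matrix α α F} {r : ℝ} {t : ℕ} (h : NonRigid A r t) :
    NonRigid A.transpose r t := by
  obtain ⟨Z, h1, h2, h3⟩ := h
  refine ⟨Z.transpose, ?_, h3, h2⟩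
  rw [← Matrix.transpose_sub, Matrix.rank_transpose]
  exact h1

theorem of_submatrix {A : Matrix α α F} (e f : β ≃ α) {r : ℝ} {t : ℕ}
    (h : NonRigid (A.submatrix e f) r t) : NonRigid A r t := by
  obtain ⟨Z, h1, h2, h3⟩ := h
  refine ⟨Z.submatrix e.symm f.symm, ?_, fun i => ?_, fun j => ?_⟩
  · have : A - Z.submatrix e.symm f.symm = (A.submatrix e f - Z).submatrix e.symm f.symm := by
      ext i j
      simp
    rw [this, Matrix.rank_submatrix]
    exact h1
  · refine le_trans (le_of_eq ?_) (h2 (e.symm i))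
    rw [← Set.ncard_image_of_injective _ f.injective]
    congr 1
    ext j
    simp only [Matrix.submatrix_apply, Set.mem_ofPred_eq, Set.mem_image]
    exact ⟨fun h => ⟨f.symm j, h, by simp⟩, by rintro ⟨k, hk, rfl⟩; simpa using hk⟩
  · refine le_trans (le_of_eq ?_) (h3 (f.symm j))
    rw [← Set.ncard_image_of_injective _ e.injective]
    congr 1
    ext i
    simp only [Matrix.submatrix_apply, Set.mem_ofPred_eq, Set.mem_image]
    exact ⟨fun h => ⟨e.symm i, h, by simp⟩, by rintro ⟨k, hk, rfl⟩; simpa using hk⟩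

theorem ncard_mul_support_le {A B : Matrix α α F} {s t : ℕ}
    (hA : ∀ i, {j | A i j ≠ 0}.ncard ≤ s) (hB : ∀ i, {j | B i j ≠ 0}.ncard ≤ t) (i : α) :
    {j | (A * B) i j ≠ 0}.ncard ≤ s * t := by
  classical
  have hA' : (Finset.univ.filter fun k => A i k ≠ 0).card ≤ s := by
    have := hA i
    rwa [Set.ncard_eq_toFinset_card', Set.toFinset_ofPred] at this
  have hB' (k) : (Finset.univ.filter fun j => B k j ≠ 0).card ≤ t := by
    have := hB k
    rwa [Set.ncard_eq_toFinset_card', Set.toFinset_ofPred] at this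
  have hsub : {j | (A * B) i j ≠ 0} ⊆
      ((Finset.univ.filter fun k => A i k ≠ 0).biUnion
        fun k => Finset.univ.filter fun j => B k j ≠ 0 : Finset α) := by
    intro j hj
    rw [Set.mem_ofPred_eq, Matrix.mul_apply] at hj
    obtain ⟨k, -, hk⟩ := Finset.exists_ne_zero_of_sum_ne_zero hj
    simp only [Finset.coe_biUnion, Set.mem_iUnion]
    exact ⟨k, by simpa using left_ne_zero_of_mul hk, by simpa using right_ne_zero_of_mul hk⟩
  refine (Set.ncard_le_ncard hsub (Finset.finite_toSet _)).trans ?_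
  rw [Set.ncard_coe_finset]
  exact (Finset.card_biUnion_le_card_mul _ _ t fun k _ => hB' k).trans
    (Nat.mul_le_mul_right _ hA')

theorem mul {A B : Matrix α α F} {r₁ r₂ : ℝ} {t₁ t₂ : ℕ} (hA : NonRigid A r₁ t₁)
    (hB : NonRigid B r₂ t₂) : NonRigid (A * B) (r₁ + r₂) (t₁ * t₂) := by
  obtain ⟨Y, a1, a2, a3⟩ := hA
  obtain ⟨Z, b1, b2, b3⟩ := hB
  refine ⟨Y * Z, ?_, ncard_mul_support_le a2 b2, fun j => ?_⟩
  · have h : A * B - Y * Z = (A - Y) * B + Y * (B - Z) := by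
      rw [Matrix.sub_mul, Matrix.mul_sub]
      abel
    have h1 : (A * B - Y * Z).rank ≤ (A - Y).rank + (B - Z).rank := by
      rw [h]
      exact (Matrix.rank_add_le _ _).trans
        (add_le_add (Matrix.rank_mul_le_left _ _) (Matrix.rank_mul_le_right _ _))
    calc ((A * B - Y * Z).rank : ℝ) ≤ (A - Y).rank + (B - Z).rank := by exact_mod_cast h1
      _ ≤ r₁ + r₂ := add_le_add a1 b1
  · have := ncard_mul_support_le (A := Z.transpose) (B := Y.transpose) b3 a3 j
    rw [← Matrix.transpose_mul, mul_comm] at this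
    exact this

/-- Row-reduce both factors: the reduced product vanishes outside the rows in `R ×ˢ R'`, and undoing
the reduction is a left multiplication. -/
theorem rank_kroneckerMap_le {γ : Type*} [Fintype γ] (A : Matrix α α F) (B : Matrix γ γ F) :
    (Matrix.kroneckerMap (· * ·) A B).rank ≤ A.rank * B.rank := by
  classical
  obtain ⟨P, Q, R, hQP, hR, hz⟩ := A.exists_row_reduction
  obtain ⟨P', Q', R', hQP', hR', hz'⟩ := B.exists_row_reduction
  have h : Matrix.kroneckerMap (· * ·) A B = Matrix.kroneckerMap (· * ·) Q Q' *
      Matrix.kroneckerMap (· * ·) (P * A) (P' * B) := by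
    have := Matrix.mul_kronecker_mul Q (P * A) Q' (P' * B)
    rw [← Matrix.mul_assoc, ← Matrix.mul_assoc, hQP, hQP', Matrix.one_mul, Matrix.one_mul] at this
    exact this
  rw [h, ← hR, ← hR', ← Finset.card_product]
  refine (Matrix.rank_mul_le_right _ _).trans (Matrix.rank_le_card_of_row_support _ _ ?_)
  rintro ⟨i, i'⟩ hi ⟨j, j'⟩
  rw [Finset.mem_product, not_and_or] at hi
  rcases hi with hi | hi
  · simp [hz i hi]
  · simp [hz' i' hi]

theorem kronecker {A : Matrix α α F} {B : Matrix β β F} {r₁ r₂ : ℝ} {t₁ t₂ : ℕ}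
    (hA : NonRigid A r₁ t₁) (hB : NonRigid B r₂ t₂) :
    NonRigid (Matrix.kroneckerMap (· * ·) A B)
      (r₁ * Fintype.card β + Fintype.card α * r₂) (t₁ * t₂) := by
  obtain ⟨Y, a1, a2, a3⟩ := hA
  obtain ⟨Z, b1, b2, b3⟩ := hB
  refine ⟨Matrix.kroneckerMap (· * ·) Y Z, ?_, ?_, ?_⟩
  · have h : Matrix.kroneckerMap (· * ·) A B - Matrix.kroneckerMap (· * ·) Y Z =
        Matrix.kroneckerMap (· * ·) (A - Y) B + Matrix.kroneckerMap (· * ·) Y (B - Z) := by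
      ext ⟨i, i'⟩ ⟨j, j'⟩
      simp only [Matrix.sub_apply, Matrix.add_apply, Matrix.kroneckerMap_apply]
      ring
    have h1 : (Matrix.kroneckerMap (· * ·) A B - Matrix.kroneckerMap (· * ·) Y Z).rank ≤
        (A - Y).rank * Fintype.card β + Fintype.card α * (B - Z).rank := by
      rw [h]
      refine (Matrix.rank_add_le _ _).trans (add_le_add ?_ ?_)
      · exact (rank_kroneckerMap_le _ _).trans (Nat.mul_le_mul_left _ B.rank_le_card_width)
      · exact (rank_kroneckerMap_le _ _).trans (Nat.mul_le_mul_right _ Y.rank_le_card_width)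
    calc _ ≤ ((A - Y).rank : ℝ) * Fintype.card β + Fintype.card α * (B - Z).rank := by
          exact_mod_cast h1
      _ ≤ _ := by gcongr
  · rintro ⟨i, i'⟩
    refine le_trans (le_of_eq ?_) (Nat.mul_le_mul (a2 i) (b2 i'))
    rw [← Set.ncard_prod]
    congr 1
    ext ⟨j, j'⟩
    simp
  · rintro ⟨j, j'⟩
    refine le_trans (le_of_eq ?_) (Nat.mul_le_mul (a3 j) (b3 j'))
    rw [← Set.ncard_prod]
    congr 1
    ext ⟨i, i'⟩
    simp

end NonRigid

/-! ### Kronecker products of finite families -/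

/-- The Kronecker product of a finite family of square matrices. -/
def piKron {F ι : Type*} [Field F] [Fintype ι] {α : ι → Type*}
    (M : ∀ i, Matrix (α i) (α i) F) : Matrix (∀ i, α i) (∀ i, α i) F :=
  Matrix.of fun x y => ∏ i, M i (x i) (y i)

theorem piKron_apply {F ι : Type*} [Field F] [Fintype ι] {α : ι → Type*}
    (M : ∀ i, Matrix (α i) (α i) F) (x y : ∀ i, α i) :
    piKron M x y = ∏ i, M i (x i) (y i) := rfl

theorem piKron_one {F ι : Type*} [Field F] [Fintype ι] [DecidableEq ι] {α : ι → Type*}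
    [∀ i, DecidableEq (α i)] [DecidableEq (∀ i, α i)] :
    piKron (fun i => (1 : Matrix (α i) (α i) F)) = 1 := by
  ext x y
  rw [piKron_apply, Matrix.one_apply]
  split_ifs with h
  · rw [h]
    exact Finset.prod_eq_one fun i _ => Matrix.one_apply_eq _
  · obtain ⟨i, hi⟩ := Function.ne_iff.1 h
    exact Finset.prod_eq_zero (Finset.mem_univ i) (Matrix.one_apply_ne hi)

theorem piKron_mul {F ι : Type*} [Field F] [Fintype ι] [DecidableEq ι] {α : ι → Type*}
    [∀ i, Fintype (α i)] (M N : ∀ i, Matrix (α i) (α i) F) :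
    piKron M * piKron N = piKron fun i => M i * N i := by
  ext x y
  simp only [Matrix.mul_apply, piKron_apply, ← Finset.prod_mul_distrib]
  rw [Finset.prod_univ_sum, Fintype.piFinset_univ]

theorem piKron_add {F ι : Type*} [Field F] [Fintype ι] [DecidableEq ι] {α : ι → Type*}
    (M N : ∀ i, Matrix (α i) (α i) F) :
    (piKron fun i => M i + N i) =
      ∑ S : Finset ι, piKron fun i => if i ∈ S then M i else N i := by
  ext x y
  rw [piKron_apply, Matrix.sum_apply]
  simp only [Matrix.add_apply, piKron_apply]
  rw [Finset.prod_add, Finset.powerset_univ]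
  refine Finset.sum_congr rfl fun S _ => ?_
  rw [← Finset.prod_mul_prod_compl S (fun i => (if i ∈ S then M i else N i) (x i) (y i)),
    ← Finset.compl_eq_univ_sdiff]
  congr 1
  · exact Finset.prod_congr rfl fun i hi => by simp [hi]
  · exact Finset.prod_congr rfl fun i hi => by simp [Finset.mem_compl.1 hi]

/-! ### Counting tuples by exponential moments -/

/-- An exponential-moment bound for the number of tuples with a property. -/
theorem card_filter_le_prod_sum {ι : Type*} [Fintype ι] [DecidableEq ι] {α : ι → Type*}
    [∀ i, Fintype (α i)] (P : (∀ i, α i) → Prop) [DecidablePred P] (f : ∀ i, α i → ℝ)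
    (hf : ∀ i a, 0 ≤ f i a) {c : ℝ} (hc : 0 ≤ c) (hP : ∀ x, P x → 1 ≤ c * ∏ i, f i (x i)) :
    ((Finset.univ.filter P).card : ℝ) ≤ c * ∏ i, ∑ a, f i a := by
  rw [Finset.prod_univ_sum, Fintype.piFinset_univ, Finset.mul_sum, Finset.card_eq_sum_ones,
    Nat.cast_sum, Finset.sum_filter]
  refine Finset.sum_le_sum fun x _ => ?_
  split_ifs with h
  · simpa using hP x h
  · exact mul_nonneg hc (Finset.prod_nonneg fun i _ => hf i _)

/-- Few tuples violate a property in coordinates of small total weight `∑ log d i`. -/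
theorem card_filter_weight_le {ι : Type*} [Fintype ι] [DecidableEq ι] {d : ι → ℕ}
    (hd : ∀ i, 0 < d i) (p : ∀ i, Fin (d i) → Prop) [∀ i, DecidablePred (p i)] (t : ι → ℕ)
    (ht : ∀ i, (Finset.univ.filter (p i)).card ≤ t i) (T : ℝ) :
    ((Finset.univ.filter fun y : ∀ i, Fin (d i) =>
      ∑ i with ¬ p i (y i), Real.log (d i) ≤ T).card : ℝ) ≤
        Real.exp T * ∏ i, ((t i : ℝ) + 1) := by
  -- A violating coordinate gets weight `1 / d i`; all `d i` values together then add at most `1` to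
  -- the `t i` good ones.
  refine (card_filter_le_prod_sum _
    (fun i a => Real.exp (if ¬ p i a then - Real.log (d i) else 0))
    (fun i a => (Real.exp_pos _).le) (Real.exp_pos T).le fun y hy => ?_).trans ?_
  · rw [← Real.exp_sum, ← Real.exp_add, Real.one_le_exp_iff, ← Finset.sum_filter,
      Finset.sum_neg_distrib]
    linarith
  · refine mul_le_mul_of_nonneg_left ?_ (Real.exp_pos T).le
    refine Finset.prod_le_prod (fun i _ => Finset.sum_nonneg fun a _ => (Real.exp_pos _).le)
      fun i _ => ?_
    have h0 : (0 : ℝ) < d i := by exact_mod_cast hd i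
    have h1 : ∀ a, Real.exp (if ¬ p i a then - Real.log (d i) else 0) ≤
        (if p i a then 1 else 0) + (d i : ℝ)⁻¹ := by
      intro a
      by_cases h : p i a
      · simp [h]
      · simp [h, Real.exp_neg, Real.exp_log h0]
    refine (Finset.sum_le_sum fun a _ => h1 a).trans ?_
    rw [Finset.sum_add_distrib, Finset.sum_boole, Finset.sum_const, Finset.card_univ,
      Fintype.card_fin, nsmul_eq_mul, mul_inv_cancel₀ h0.ne']
    have : ((Finset.univ.filter (p i)).card : ℝ) ≤ t i := by exact_mod_cast ht i
    linarith

/-- Chernoff bound for the number of tuples having coordinates of large total weight in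
the sets `R i`. -/
theorem card_filter_weight_gt {ι : Type*} [Fintype ι] [DecidableEq ι] {d : ι → ℕ}
    (hd : ∀ i, 0 < d i) (R : ∀ i, Finset (Fin (d i))) {s ε : ℝ} (hs : 0 ≤ s)
    (hR : ∀ i, ((R i).card : ℝ) * Real.exp (s * Real.log (d i)) ≤ d i * (ε / 2)) (T : ℝ) :
    ((Finset.univ.filter fun x : ∀ i, Fin (d i) =>
      T < ∑ i with x i ∈ R i, Real.log (d i)).card : ℝ) ≤
        Real.exp (- (s * T) + ∑ i, (1 + s * (ε / 2)) * Real.log (d i)) := by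
  refine (card_filter_le_prod_sum _
    (fun i a => Real.exp (if a ∈ R i then s * Real.log (d i) else 0))
    (fun i a => (Real.exp_pos _).le) (Real.exp_pos (-(s * T))).le fun y hy => ?_).trans ?_
  · rw [← Real.exp_sum, ← Real.exp_add, Real.one_le_exp_iff, ← Finset.sum_filter,
      ← Finset.mul_sum]
    nlinarith
  · rw [Real.exp_add, Real.exp_sum]
    refine mul_le_mul_of_nonneg_left ?_ (Real.exp_pos _).le
    refine Finset.prod_le_prod (fun i _ => Finset.sum_nonneg fun a _ => (Real.exp_pos _).le)
      fun i _ => ?_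
    have h0 : (0 : ℝ) < d i := by exact_mod_cast hd i
    have hl : 0 ≤ Real.log (d i) := Real.log_natCast_nonneg _
    set u := s * Real.log (d i) with hu
    have hu0 : 0 ≤ u := mul_nonneg hs hl
    have h1 : ∀ a, Real.exp (if a ∈ R i then u else 0) =
        1 + if a ∈ R i then Real.exp u - 1 else 0 := by
      intro a
      split_ifs <;> simp
    have h2 : ∑ a, Real.exp (if a ∈ R i then u else 0) =
        d i + (R i).card * (Real.exp u - 1) := by
      simp only [h1]
      rw [Finset.sum_add_distrib, Finset.sum_ite_mem, Finset.univ_inter, Finset.sum_const,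
        Finset.sum_const, Finset.card_univ, Fintype.card_fin, nsmul_eq_mul, nsmul_eq_mul, mul_one]
    -- This form leaves a factor `exp u` to be absorbed by `hR` and a factor `u` proportional to
    -- `log (d i)`.
    have h3 : Real.exp u - 1 ≤ u * Real.exp u := by
      have h4 := Real.add_one_le_exp (-u)
      have h5 : Real.exp (-u) * Real.exp u = 1 := by rw [← Real.exp_add]; simp
      nlinarith [Real.exp_pos u]
    calc ∑ a, Real.exp (if a ∈ R i then u else 0)
        = d i + (R i).card * (Real.exp u - 1) := h2
      _ ≤ d i + (R i).card * (u * Real.exp u) := by gcongr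
      _ = d i + ((R i).card * Real.exp u) * u := by ring
      _ ≤ d i + (d i * (ε / 2)) * u := by
          gcongr _ + ?_ * _
          exact hR i
      _ = d i * (ε / 2 * u + 1) := by ring
      _ ≤ d i * Real.exp (ε / 2 * u) := by gcongr; exact Real.add_one_le_exp _
      _ = Real.exp ((1 + s * (ε / 2)) * Real.log (d i)) := by
          nth_rewrite 1 [← Real.exp_log h0]
          rw [← Real.exp_add, hu]
          ring_nf

/-! ### Factors of small rank plus sparse -/

/-- A Kronecker product of factors that are sparse perturbations of matrices of small rank is
itself non-rigid. -/
theorem NonRigid.piKron_of_small_rank {F ι : Type*} [Field F] [Fintype ι] [DecidableEq ι]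
    {d : ι → ℕ} (hd : ∀ i, 0 < d i) (M : ∀ i, Matrix (Fin (d i)) (Fin (d i)) F) {s ε : ℝ}
    (hs : 0 ≤ s) (r : ι → ℝ) (t : ι → ℕ) (hM : ∀ i, NonRigid (M i) (r i) (t i))
    (hr : ∀ i, r i * Real.exp (s * Real.log (d i)) ≤ d i * (ε / 2))
    (ht : ∀ i, (t i : ℝ) + 1 ≤ Real.exp (2 * ε * Real.log (d i))) :
    NonRigid (piKron M) (Real.exp ((1 - s * (ε / 2)) * ∑ i, Real.log (d i)))
      ⌊Real.exp (3 * ε * ∑ i, Real.log (d i))⌋₊ := by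
  classical
  choose Z hZr hZ hZ' using hM
  choose P Q R hQP hRc hPL using fun i => (M i - Z i).exists_row_reduction
  set Λ := ∑ i, Real.log (d i) with hΛ
  have hl : ∀ i, 0 ≤ Real.log (d i) := fun i => Real.log_natCast_nonneg _
  set K : Finset ι → Matrix (∀ i, Fin (d i)) (∀ i, Fin (d i)) F :=
    fun S => piKron fun i => if i ∈ S then M i - Z i else Z i with hK
  have hsum : piKron M = ∑ S, K S := by
    rw [← piKron_add]
    simp
  have key : ∀ S : Finset ι, ∀ x y, K S x y ≠ 0 → ∀ i ∉ S, Z i (x i) (y i) ≠ 0 := by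
    intro S x y h i hi
    have := Finset.prod_ne_zero_iff.1 h i (Finset.mem_univ i)
    simpa [hi] using this
  have count : ∀ p : ∀ i, Fin (d i) → Prop, (∀ i, {a | p i a}.ncard ≤ t i) →
      ∀ V : Set (∀ i, Fin (d i)),
        (∀ y ∈ V, ∃ S : Finset ι, ∑ i ∈ S, Real.log (d i) ≤ ε * Λ ∧ ∀ i ∉ S, p i (y i)) →
        V.ncard ≤ ⌊Real.exp (3 * ε * Λ)⌋₊ := by
    intro p hp V hV
    refine Nat.le_floor ?_
    have h1 : V ⊆ (Finset.univ.filter fun y : ∀ i, Fin (d i) =>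
        ∑ i with ¬ p i (y i), Real.log (d i) ≤ ε * Λ : Finset _) := by
      intro y hy
      obtain ⟨S, hS, hS'⟩ := hV y hy
      simp only [Finset.coe_filter, Finset.mem_univ, true_and, Set.mem_ofPred_eq]
      refine le_trans (Finset.sum_le_sum_of_subset_of_nonneg ?_ fun i _ _ => hl i) hS
      intro i hi
      by_contra hiS
      exact (Finset.mem_filter.1 hi).2 (hS' i hiS)
    have h2 := Set.ncard_le_ncard h1 (Finset.finite_toSet _)
    rw [Set.ncard_coe_finset] at h2
    have h3 := card_filter_weight_le hd p t (fun i => by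
      have := hp i
      rwa [Set.ncard_eq_toFinset_card', Set.toFinset_ofPred] at this) (ε * Λ)
    calc (V.ncard : ℝ) ≤ _ := Nat.cast_le.2 h2
      _ ≤ _ := h3
      -- The unconstrained coordinates of `S` cost `exp (εΛ)`, the sparse choices `exp (2εΛ)`.
      _ ≤ Real.exp (ε * Λ) * ∏ i, Real.exp (2 * ε * Real.log (d i)) := by
          gcongr with i _
          exact ht i
      _ = Real.exp (3 * ε * Λ) := by
          rw [← Real.exp_sum, ← Real.exp_add, ← Finset.mul_sum, ← hΛ]
          ring_nf
  -- The change consists of the terms with light `S`; the heavy ones must have small rank.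
  refine ⟨∑ S with ∑ i ∈ S, Real.log (d i) ≤ ε * Λ, K S, ?_, fun x => ?_, fun y => ?_⟩
  · have hlow : piKron M - ∑ S with ∑ i ∈ S, Real.log (d i) ≤ ε * Λ, K S =
        ∑ S with ¬ ∑ i ∈ S, Real.log (d i) ≤ ε * Λ, K S := by
      rw [hsum, sub_eq_iff_eq_add', Finset.sum_filter_add_sum_filter_not]
    rw [hlow]
    set Low := ∑ S with ¬ ∑ i ∈ S, Real.log (d i) ≤ ε * Λ, K S with hLow
    -- Left multiplication by `piKron P` is undone by `piKron Q`. Afterwards a heavy term has a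
    -- non-zero row `x` only if `x i ∈ R i` for all `i ∈ S`, which makes the weight of these
    -- coordinates exceed `εΛ`.
    have hfac : Low = piKron Q * (piKron P * Low) := by
      rw [← Matrix.mul_assoc, piKron_mul]
      simp only [hQP]
      rw [piKron_one, Matrix.one_mul]
    have hrank : Low.rank ≤ (Finset.univ.filter fun x : ∀ i, Fin (d i) =>
        ε * Λ < ∑ i with x i ∈ R i, Real.log (d i)).card := by
      rw [hfac]
      refine (Matrix.rank_mul_le_right _ _).trans
        (Matrix.rank_le_card_of_row_support _ _ fun x hx y => ?_)
      rw [hLow, Matrix.mul_sum, Matrix.sum_apply]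
      refine Finset.sum_eq_zero fun S hS => ?_
      have hS' := (Finset.mem_filter.1 hS).2
      obtain ⟨i, hiS, hi⟩ : ∃ i ∈ S, x i ∉ R i := by
        by_contra! hcon
        refine hx (Finset.mem_filter.2 ⟨Finset.mem_univ _, ?_⟩)
        refine (not_le.1 hS').trans_le
          (Finset.sum_le_sum_of_subset_of_nonneg ?_ fun i _ _ => hl i)
        exact fun i hi => Finset.mem_filter.2 ⟨Finset.mem_univ _, hcon i hi⟩
      simp only [hK]
      rw [piKron_mul, piKron_apply]
      refine Finset.prod_eq_zero (Finset.mem_univ i) ?_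
      simp [hiS, hPL i _ hi]
    calc (Low.rank : ℝ) ≤ _ := Nat.cast_le.2 hrank
      _ ≤ _ := card_filter_weight_gt hd R (ε := ε) hs (fun i => by
          refine le_trans ?_ (hr i)
          rw [hRc]
          gcongr
          exact hZr i) _
      _ = _ := by
          rw [← Finset.mul_sum, ← hΛ]
          ring_nf
  · refine count (fun i a => Z i (x i) a ≠ 0) (fun i => hZ i (x i)) _ fun y hy => ?_
    rw [Set.mem_ofPred_eq, Matrix.sum_apply] at hy
    obtain ⟨S, hS, hne⟩ := Finset.exists_ne_zero_of_sum_ne_zero hy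
    exact ⟨S, (Finset.mem_filter.1 hS).2, key S x y hne⟩
  · refine count (fun i a => Z i a (y i) ≠ 0) (fun i => hZ' i (y i)) _ fun x hx => ?_
    rw [Set.mem_ofPred_eq, Matrix.sum_apply] at hx
    obtain ⟨S, hS, hne⟩ := Finset.exists_ne_zero_of_sum_ne_zero hx
    exact ⟨S, (Finset.mem_filter.1 hS).2, key S x y hne⟩

/-! ### Factors of bounded order -/

/-- Every square matrix over a field is, after permuting its rows, a lower triangular matrix
times an upper triangular one. -/
theorem Matrix.exists_perm_lower_mul_upper {F : Type*} [Field F] {d : ℕ}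
    (A : Matrix (Fin d) (Fin d) F) :
    ∃ (σ : Equiv.Perm (Fin d)) (L U : Matrix (Fin d) (Fin d) F),
      (∀ i j, i < j → L i j = 0) ∧ (∀ i j, j < i → U i j = 0) ∧
        A.submatrix σ (Equiv.refl _) = L * U := by
  induction d with
  | zero => exact ⟨1, 0, 0, fun i => i.elim0, fun i => i.elim0, Subsingleton.elim _ _⟩
  | succ d ih =>
    -- `v` is the column of elimination multipliers after moving a pivot to row `0`. If the first
    -- column is zero there is no pivot and `v = 1` serves.
    obtain ⟨σ, v, hv0, hv⟩ : ∃ (σ : Equiv.Perm (Fin (d + 1))) (v : Fin (d + 1) → F), v 0 = 1 ∧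
        ∀ i, A (σ i) 0 = v i * A (σ 0) 0 := by
      by_cases h : ∀ i, A i 0 = 0
      · exact ⟨1, 1, rfl, fun i => by simp [h]⟩
      · push Not at h
        obtain ⟨p, hp⟩ := h
        refine ⟨Equiv.swap 0 p, fun i => A (Equiv.swap 0 p i) 0 / A p 0, ?_, fun i => ?_⟩
        · simp [hp]
        · simp [hp]
    obtain ⟨τ, L, U, hL, hU, hLU⟩ := ih (Matrix.of fun i j : Fin d =>
      A (σ i.succ) j.succ - v i.succ * A (σ 0) j.succ)
    -- The permutation `τ` for the Schur complement is extended to fix `0`; the multipliers below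
    -- the pivot are permuted along with their rows.
    refine ⟨(Equiv.Perm.decomposeFin.symm (0, τ)).trans σ,
      Matrix.of (Fin.cons (Fin.cons 1 0) fun i => Fin.cons (v (τ i).succ) (L i)),
      Matrix.of (Fin.cons (A (σ 0)) fun i => Fin.cons 0 (U i)), ?_, ?_, ?_⟩
    · intro i j
      refine Fin.cases ?_ (fun i => ?_) i <;> refine Fin.cases ?_ (fun j => ?_) j
      · simp
      · simp
      · simp
      · simpa using hL i j
    · intro i j
      refine Fin.cases ?_ (fun i => ?_) i <;> refine Fin.cases ?_ (fun j => ?_) j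
      · simp
      · simp
      · simp
      · simpa using hU i j
    · ext i j
      rw [Matrix.mul_apply, Fin.sum_univ_succ]
      refine Fin.cases ?_ (fun i => ?_) i
      · simp
      · refine Fin.cases ?_ (fun j => ?_) j
        · simp [hv (τ i).succ]
        · have := congrFun (congrFun hLU i) j
          simp only [Matrix.submatrix_apply, Matrix.of_apply, Equiv.refl_apply,
            Matrix.mul_apply] at this
          simp [← this]

/-- Turns per-coordinate bounds in `d i - 1` into multiples of `log (d i)`, so that they sum to `Λ`.
Factors of order `1` cost nothing. -/
theorem natCast_sub_one_le_mul_log {n D : ℕ} (hn : 0 < n) (hD : n ≤ D) :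
    (n : ℝ) - 1 ≤ D * Real.log n := by
  have h0 : (0 : ℝ) < n := by exact_mod_cast hn
  have h1 := Real.one_sub_inv_le_log_of_pos h0
  have h2 : (n : ℝ) - 1 = n * (1 - (n : ℝ)⁻¹) := by field_simp
  rw [h2]
  have hD' : (n : ℝ) ≤ D := by exact_mod_cast hD
  have hl : 0 ≤ Real.log n := Real.log_natCast_nonneg _
  calc (n : ℝ) * (1 - (n : ℝ)⁻¹) ≤ n * Real.log n := by gcongr
    _ ≤ D * Real.log n := by gcongr

/-- Chernoff bound for sums of centred functions of independent coordinates. -/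
theorem card_filter_centred_sum_gt {ι : Type*} [Fintype ι] [DecidableEq ι] {d : ι → ℕ} {D : ℕ}
    (hd : ∀ i, 0 < d i) (hD : ∀ i, d i ≤ D) (g : ∀ i, Fin (d i) → ℝ)
    (hg : ∀ i a, |g i a| ≤ d i - 1) (hg0 : ∀ i, ∑ a, g i a = 0) {s : ℝ} (hs : 0 ≤ s)
    (hsD : s * D ≤ 1) (θ : ℝ) :
    ((Finset.univ.filter fun x : ∀ i, Fin (d i) => θ < ∑ i, g i (x i)).card : ℝ) ≤
      Real.exp (-(s * θ) + (1 + s ^ 2 * D ^ 2) * ∑ i, Real.log (d i)) := by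
  refine (card_filter_le_prod_sum _ (fun i a => Real.exp (s * g i a))
    (fun i a => (Real.exp_pos _).le) (Real.exp_pos (-(s * θ))).le fun y hy => ?_).trans ?_
  · rw [← Real.exp_sum, ← Real.exp_add, Real.one_le_exp_iff, ← Finset.mul_sum]
    nlinarith
  · rw [Real.exp_add, Finset.mul_sum, Real.exp_sum]
    refine mul_le_mul_of_nonneg_left ?_ (Real.exp_pos _).le
    refine Finset.prod_le_prod (fun i _ => Finset.sum_nonneg fun a _ => (Real.exp_pos _).le)
      fun i _ => ?_
    have h0 : (0 : ℝ) < d i := by exact_mod_cast hd i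
    have h1 : (1 : ℝ) ≤ d i := by exact_mod_cast hd i
    have hD' : (d i : ℝ) ≤ D := by exact_mod_cast hD i
    have hlog := natCast_sub_one_le_mul_log (hd i) (hD i)
    -- Here `exp z ≤ 1 + z + z²` for `|z| ≤ 1`; the linear term disappears on summing over `a`. One
    -- factor of `g²` is bounded by `D`, the other by `D * log (d i)`.
    have hpt : ∀ a, Real.exp (s * g i a) ≤ 1 + s * g i a + s ^ 2 * (D * (D * Real.log (d i))) := by
      intro a
      have ha := hg i a
      have h2 : |s * g i a| ≤ 1 := by
        rw [abs_mul, abs_of_nonneg hs]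
        refine le_trans ?_ hsD
        gcongr
        linarith
      have h3 := (abs_le.1 (Real.abs_exp_sub_one_sub_id_le h2)).2
      have h4 : g i a ^ 2 ≤ D * (D * Real.log (d i)) := by
        rw [← sq_abs, sq]
        have := abs_nonneg (g i a)
        apply mul_le_mul <;> linarith
      have h5 : s ^ 2 * g i a ^ 2 ≤ s ^ 2 * (D * (D * Real.log (d i))) := by gcongr
      linarith [mul_pow s (g i a) 2]
    calc ∑ a, Real.exp (s * g i a)
        ≤ ∑ a, (1 + s * g i a + s ^ 2 * (D * (D * Real.log (d i)))) :=
          Finset.sum_le_sum fun a _ => hpt a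
      _ = d i * (s ^ 2 * D ^ 2 * Real.log (d i) + 1) := by
          rw [Finset.sum_add_distrib, Finset.sum_add_distrib, ← Finset.mul_sum, hg0]
          simp only [Finset.sum_const, Finset.card_univ, Fintype.card_fin, nsmul_eq_mul]
          ring
      _ ≤ d i * Real.exp (s ^ 2 * D ^ 2 * Real.log (d i)) := by
          gcongr
          exact Real.add_one_le_exp _
      _ = Real.exp ((1 + s ^ 2 * D ^ 2) * Real.log (d i)) := by
          nth_rewrite 1 [← Real.exp_log h0]
          rw [← Real.exp_add]
          ring_nf

/-- The size of a Hamming ball in a product of small sets. -/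
theorem card_filter_hamming_le {ι : Type*} [Fintype ι] [DecidableEq ι] {d : ι → ℕ} {D : ℕ}
    (hd : ∀ i, 0 < d i) (hD : ∀ i, d i ≤ D) (x : ∀ i, Fin (d i)) {u : ℝ} (hu : 0 ≤ u) (θ : ℝ) :
    ((Finset.univ.filter fun y : ∀ i, Fin (d i) =>
      ((Finset.univ.filter fun i => y i ≠ x i).card : ℝ) ≤ θ).card : ℝ) ≤
        Real.exp (u * θ + D * Real.exp (-u) * ∑ i, Real.log (d i)) := by
  refine (card_filter_le_prod_sum _ (fun i a => Real.exp (if a ≠ x i then -u else 0))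
    (fun i a => (Real.exp_pos _).le) (Real.exp_pos (u * θ)).le fun y hy => ?_).trans ?_
  · rw [← Real.exp_sum, ← Real.exp_add, Real.one_le_exp_iff, ← Finset.sum_filter,
      Finset.sum_const, nsmul_eq_mul]
    nlinarith
  · rw [Real.exp_add, Finset.mul_sum, Real.exp_sum]
    refine mul_le_mul_of_nonneg_left ?_ (Real.exp_pos _).le
    refine Finset.prod_le_prod (fun i _ => Finset.sum_nonneg fun a _ => (Real.exp_pos _).le)
      fun i _ => ?_
    have h1 : ∑ a, Real.exp (if a ≠ x i then -u else 0) = ((d i : ℝ) - 1) * Real.exp (-u) + 1 := by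
      rw [← Finset.add_sum_erase _ _ (Finset.mem_univ (x i)),
        Finset.sum_congr rfl (g := fun _ => Real.exp (-u))]
      · rw [Finset.sum_const, Finset.card_erase_of_mem (Finset.mem_univ _), Finset.card_univ,
          Fintype.card_fin, nsmul_eq_mul, Nat.cast_sub (hd i)]
        simp [add_comm]
      · intro a ha
        simp [Finset.ne_of_mem_erase ha]
    rw [h1]
    refine (Real.add_one_le_exp _).trans (Real.exp_le_exp.2 ?_)
    nlinarith [natCast_sub_one_le_mul_log (hd i) (hD i), Real.exp_pos (-u)]

theorem Fin.sum_val_sub_mean {n : ℕ} (hn : 0 < n) :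
    ∑ a : Fin n, ((a : ℝ) - (n - 1) / 2) = 0 := by
  rw [Finset.sum_sub_distrib, Fin.sum_univ_eq_sum_range (fun a => (a : ℝ)) n, ← Nat.cast_sum]
  have h := Finset.sum_range_id_mul_two n
  have h' : ((∑ i ∈ Finset.range n, i : ℕ) : ℝ) * 2 = n * (n - 1) := by
    have h2 : (((n - 1 : ℕ) : ℝ)) = n - 1 := by rw [Nat.cast_sub hn, Nat.cast_one]
    rw [← h2]
    exact_mod_cast h
  simp only [Finset.sum_const, Finset.card_univ, Fintype.card_fin, nsmul_eq_mul]
  linarith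

theorem Fin.abs_val_sub_mean_le {n : ℕ} (a : Fin n) : |(a : ℝ) - (n - 1) / 2| ≤ n - 1 := by
  have h : (a : ℝ) + 1 ≤ n := by exact_mod_cast a.2
  have h0 : (0 : ℝ) ≤ a := Nat.cast_nonneg _
  rw [abs_le]
  constructor <;> linarith

/-- Kronecker products of upper triangular matrices of bounded order are non-rigid: outside the
rows with small and the columns with large coordinate sum, the non-zero entries `(x, y)` have
`x ≤ y` with few differing coordinates. -/
theorem NonRigid.piKron_upper {F ι : Type*} [Field F] [Fintype ι] [DecidableEq ι]
    {d : ι → ℕ} {D : ℕ} (hd : ∀ i, 0 < d i) (hD : ∀ i, d i ≤ D)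
    (U : ∀ i, Matrix (Fin (d i)) (Fin (d i)) F) (hU : ∀ i a b, b < a → U i a b = 0)
    {s u : ℝ} (hs : 0 ≤ s) (hsD : s * D ≤ 1) (hu : 0 ≤ u) (θ : ℝ) :
    NonRigid (piKron U)
      (2 * Real.exp (-(s * θ) + (1 + s ^ 2 * D ^ 2) * ∑ i, Real.log (d i)))
      ⌊Real.exp (u * (2 * θ) + D * Real.exp (-u) * ∑ i, Real.log (d i))⌋₊ := by
  classical
  set g : ∀ i, Fin (d i) → ℝ := fun i a => (a : ℝ) - (d i - 1) / 2 with hg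
  set X := Finset.univ.filter fun x : ∀ i, Fin (d i) => θ < ∑ i, -g i (x i) with hX
  set Y := Finset.univ.filter fun y : ∀ i, Fin (d i) => θ < ∑ i, g i (y i) with hY
  have hXc := card_filter_centred_sum_gt hd hD (fun i a => -g i a)
    (fun i a => by rw [abs_neg]; exact Fin.abs_val_sub_mean_le a)
    (fun i => by rw [Finset.sum_neg_distrib, Fin.sum_val_sub_mean (hd i), neg_zero]) hs hsD θ
  have hYc := card_filter_centred_sum_gt hd hD g
    (fun i a => Fin.abs_val_sub_mean_le a) (fun i => Fin.sum_val_sub_mean (hd i)) hs hsD θ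
  have close : ∀ x y, (if x ∈ X ∨ y ∈ Y then 0 else piKron U x y) ≠ 0 →
      ((Finset.univ.filter fun i => y i ≠ x i).card : ℝ) ≤ 2 * θ := by
    intro x y h
    split_ifs at h with hxy
    · exact absurd rfl h
    · rw [not_or] at hxy
      have hx : ∑ i, -g i (x i) ≤ θ := by simpa [hX] using hxy.1
      have hy : ∑ i, g i (y i) ≤ θ := by simpa [hY] using hxy.2
      have hle : ∀ i, x i ≤ y i := by
        intro i
        by_contra! hlt
        exact Finset.prod_ne_zero_iff.1 h i (Finset.mem_univ i) (hU i _ _ hlt)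
      -- Each differing coordinate adds at least `1` to `∑ (y i - x i)`; the means cancel.
      calc ((Finset.univ.filter fun i => y i ≠ x i).card : ℝ)
          = ∑ i, if y i ≠ x i then (1 : ℝ) else 0 := by rw [Finset.sum_boole]
        _ ≤ ∑ i, (g i (y i) + -g i (x i)) := by
            refine Finset.sum_le_sum fun i _ => ?_
            simp only [hg]
            split_ifs with hne
            · have : x i < y i := lt_of_le_of_ne (hle i) (Ne.symm hne)
              have : ((x i : ℕ) : ℝ) + 1 ≤ (y i : ℕ) := by exact_mod_cast this
              linarith
            · have : ((x i : ℕ) : ℝ) ≤ (y i : ℕ) := by exact_mod_cast hle i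
              linarith
        _ ≤ 2 * θ := by
            rw [Finset.sum_add_distrib]
            linarith
  have count : ∀ x : ∀ i, Fin (d i), ∀ V : Set (∀ i, Fin (d i)),
      (∀ y ∈ V, ((Finset.univ.filter fun i => y i ≠ x i).card : ℝ) ≤ 2 * θ) →
      V.ncard ≤ ⌊Real.exp (u * (2 * θ) + D * Real.exp (-u) * ∑ i, Real.log (d i))⌋₊ := by
    intro x V hV
    refine Nat.le_floor (le_trans ?_ (card_filter_hamming_le hd hD x hu (2 * θ)))
    rw [Nat.cast_le, ← Set.ncard_coe_finset]
    refine Set.ncard_le_ncard ?_ (Finset.finite_toSet _)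
    intro y hy
    simpa using hV y hy
  refine ⟨Matrix.of fun x y => if x ∈ X ∨ y ∈ Y then 0 else piKron U x y, ?_, fun x => ?_,
    fun y => ?_⟩
  · have hsplit : piKron U - Matrix.of (fun x y => if x ∈ X ∨ y ∈ Y then 0 else piKron U x y) =
        Matrix.of (fun x y => if x ∈ X then piKron U x y else 0) +
        Matrix.of (fun x y => if x ∉ X ∧ y ∈ Y then piKron U x y else 0) := by
      ext x y
      by_cases hx : x ∈ X <;> by_cases hy : y ∈ Y <;> simp [hx, hy]
    rw [hsplit]
    have h1 := (Matrix.rank_add_le _ _).trans (add_le_add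
      (Matrix.rank_le_card_of_row_support
        (Matrix.of fun x y => if x ∈ X then piKron U x y else 0) X (by
          intro x hx y
          simp [hx]))
      (Matrix.rank_le_card_of_col_support
        (Matrix.of fun x y => if x ∉ X ∧ y ∈ Y then piKron U x y else 0) Y (by
          intro y hy x
          simp [hy])))
    refine (Nat.cast_le.2 h1).trans ?_
    push_cast
    linarith
  · exact count x _ fun y hy => close x y hy
  · refine count y _ fun x hx => ?_
    have := close x y hx
    simpa only [ne_comm] using this

/-- Kronecker products of matrices of bounded order are non-rigid. -/
theorem NonRigid.piKron_of_bounded {F ι : Type*} [Field F] [Fintype ι] [DecidableEq ι]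
    {d : ι → ℕ} {D : ℕ} (hd : ∀ i, 0 < d i) (hD : ∀ i, d i ≤ D)
    (A : ∀ i, Matrix (Fin (d i)) (Fin (d i)) F)
    {s u : ℝ} (hs : 0 ≤ s) (hsD : s * D ≤ 1) (hu : 0 ≤ u) (θ : ℝ) :
    NonRigid (piKron A)
      (4 * Real.exp (-(s * θ) + (1 + s ^ 2 * D ^ 2) * ∑ i, Real.log (d i)))
      (⌊Real.exp (u * (2 * θ) + D * Real.exp (-u) * ∑ i, Real.log (d i))⌋₊ ^ 2) := by
  choose σ L U hL hU hLU using fun i => (A i).exists_perm_lower_mul_upper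
  have h1 := (NonRigid.piKron_upper hd hD (fun i => (L i).transpose)
    (fun i a b hab => hL i b a hab) hs hsD hu θ).transpose
  have h2 := h1.mul (NonRigid.piKron_upper hd hD U hU hs hsD hu θ)
  -- The row permutations of the factors combine into one row permutation of the product.
  have h3 : (piKron A).submatrix (Equiv.piCongrRight σ) (Equiv.refl _) =
      (piKron fun i => (L i).transpose).transpose * piKron U := by
    have : (piKron fun i => (L i).transpose).transpose = piKron L := rfl
    rw [this, piKron_mul]
    simp only [← hLU]
    rfl
  rw [← h3] at h2
  refine h2.of_submatrix.mono (by linarith) (by rw [sq])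

theorem sum_log_eq_log_prod {ι : Type*} [Fintype ι] {d : ι → ℕ} (hd : ∀ i, 0 < d i) :
    ∑ i, Real.log (d i) = Real.log (∏ i, d i : ℕ) := by
  rw [Nat.cast_prod, Real.log_prod]
  exact fun i _ => by exact_mod_cast (hd i).ne'

theorem card_pi_fin {ι : Type*} [Fintype ι] [DecidableEq ι] {d : ι → ℕ} (hd : ∀ i, 0 < d i) :
    (Fintype.card (∀ i, Fin (d i)) : ℝ) = Real.exp (∑ i, Real.log (d i)) := by
  rw [sum_log_eq_log_prod hd, Fintype.card_pi, Real.exp_log]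
  · simp
  · exact_mod_cast Finset.prod_pos fun i _ => hd i

/-- Kronecker products of matrices of order at most `D`: the rank drops by a power of the size. -/
theorem exists_nonRigid_piKron_of_bounded {ε : ℝ} (hε : 0 < ε) (hε1 : ε ≤ 1) (D : ℕ) :
    ∃ c : ℝ, 0 < c ∧ ∀ (F : Type u) [Field F] (ι : Type) [Fintype ι] [DecidableEq ι] (d : ι → ℕ),
      (∀ i, 0 < d i) → (∀ i, d i ≤ D) → ∀ A : ∀ i, Matrix (Fin (d i)) (Fin (d i)) F,
        NonRigid (piKron A) (4 * Real.exp ((1 - c) * ∑ i, Real.log (d i)))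
          ⌊Real.exp (2 * ε * ∑ i, Real.log (d i))⌋₊ := by
  -- `E` replaces `D` to be positive. Large `u` makes `D * exp (-u) ≤ ε / 2`; then `δ` makes `u * (2
  -- * δ) = ε / 2`; then `s` keeps the variance term `s² D²` below half the gain `s * δ`, leaving `c
  -- = s * δ / 2`.
  set E : ℝ := D + 1 with hE
  have hD0 : (0 : ℝ) ≤ D := Nat.cast_nonneg D
  have hE1 : 1 ≤ E := by linarith
  have hE0 : 0 < E := by linarith
  set u : ℝ := 2 * E / ε with hu
  have hu0 : 0 < u := by positivity
  set δ : ℝ := ε / (4 * u) with hδ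
  have hδ0 : 0 < δ := by positivity
  have hδ1 : δ ≤ 1 := by
    rw [hδ, div_le_one (by positivity)]
    have : 2 ≤ u := by
      rw [hu, le_div_iff₀ hε]
      nlinarith
    linarith
  set s : ℝ := δ / (2 * E ^ 2) with hs
  have hs0 : 0 < s := by positivity
  have hsE : s * E ^ 2 = δ / 2 := by
    rw [hs]
    field_simp
  have hsD : s * D ≤ 1 := by
    have : s * D ≤ s * E ^ 2 := by
      gcongr
      nlinarith
    linarith
  have hsD2 : s ^ 2 * D ^ 2 ≤ s * δ / 2 := by
    have : s * (s * D ^ 2) ≤ s * (s * E ^ 2) := by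
      gcongr
      linarith
    rw [hsE] at this
    linarith
  have hue : D * Real.exp (-u) ≤ ε / 2 := by
    have h1 := Real.add_one_le_exp u
    have h2 : Real.exp (-u) * Real.exp u = 1 := by rw [← Real.exp_add]; simp
    have h3 : Real.exp (-u) * u ≤ 1 := by nlinarith [Real.exp_pos (-u)]
    have h4 : Real.exp (-u) * (2 * E) ≤ ε := by
      have : Real.exp (-u) * u = Real.exp (-u) * (2 * E) / ε := by
        rw [hu]
        ring
      rwa [this, div_le_one hε] at h3
    nlinarith [Real.exp_pos (-u)]
  have huδ : u * (2 * δ) = ε / 2 := by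
    rw [hδ]
    field_simp
    norm_num
  refine ⟨s * δ / 2, by positivity, fun F _ ι _ _ d hd hD A => ?_⟩
  set Λ := ∑ i, Real.log (d i) with hΛ
  have hΛ0 : 0 ≤ Λ := Finset.sum_nonneg fun i _ => Real.log_natCast_nonneg _
  refine (NonRigid.piKron_of_bounded hd hD A hs0.le hsD hu0.le (δ * Λ)).mono ?_ ?_
  · gcongr
    nlinarith
  · refine Nat.le_floor ?_
    push_cast
    have h1 : (⌊Real.exp (u * (2 * (δ * Λ)) + D * Real.exp (-u) * Λ)⌋₊ : ℝ) ≤ Real.exp (ε * Λ) := by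
      refine (Nat.floor_le (Real.exp_pos _).le).trans (Real.exp_le_exp.2 ?_)
      nlinarith
    calc _ ≤ Real.exp (ε * Λ) ^ 2 := by gcongr
      _ = _ := by
        rw [← Real.exp_nat_mul]
        push_cast
        ring_nf

/-! ### Asymptotics in the total size -/

theorem tendsto_logb_natCast {β : ℝ} (hβ : 1 < β) :
    Tendsto (fun n : ℕ => Real.logb β n) atTop atTop :=
  (Real.tendsto_logb_atTop hβ).comp tendsto_natCast_atTop_atTop

/-- The rank saving `1 / (2 log n)` for the part of a Kronecker product with bounded factors. -/
theorem eventually_nonRigid_bounded_part {β ε : ℝ} (hβ : 1 < β) (hε : 0 < ε) (hε1 : ε ≤ 1)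
    (D : ℕ) : ∀ᶠ n : ℕ in atTop,
      ∀ (F : Type u) [Field F] (ι : Type) [Fintype ι] [DecidableEq ι] (d : ι → ℕ),
      (∀ i, 0 < d i) → (∀ i, d i ≤ D) → ∑ i, Real.log (d i) ≤ Real.log n →
      ∀ A : ∀ i, Matrix (Fin (d i)) (Fin (d i)) F,
        NonRigid (piKron A) (Real.exp (∑ i, Real.log (d i)) / (2 * Real.logb β n))
          ⌊Real.exp (2 * ε * Real.log n)⌋₊ := by
  obtain ⟨c, hc, H⟩ := exists_nonRigid_piKron_of_bounded.{u} hε hε1 D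
  have hlog : Tendsto (fun n : ℕ => Real.log n) atTop atTop :=
    Real.tendsto_log_atTop.comp tendsto_natCast_atTop_atTop
  have hlβ : 0 < Real.log β := Real.log_pos hβ
  -- For `Λ ≥ ε log n` the saving `exp (cΛ)` has to beat `8 logb β n`: the constant `4` of the rank
  -- bound times the `2` in the target.
  have hev : ∀ᶠ x : ℝ in atTop, 8 / Real.log β * x ≤ Real.exp (c * ε * x) := by
    filter_upwards [eventually_ge_atTop (16 / (Real.log β * (c * ε) ^ 2))] with x hx
    have hx0 : 0 ≤ x := le_trans (by positivity) hx
    rw [div_le_iff₀ (by positivity)] at hx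
    refine le_trans ?_ ((le_add_of_nonneg_left ?_).trans
      (Real.quadratic_le_exp_of_nonneg (x := c * ε * x) (by positivity)))
    · rw [div_mul_eq_mul_div, div_le_iff₀ hlβ]
      nlinarith
    · positivity
  filter_upwards [hlog.eventually hev, (tendsto_logb_natCast hβ).eventually_gt_atTop 0,
    hlog.eventually_gt_atTop 0] with n hn hn0 hn1 F _ ι _ _ d hd hD hle A
  set Λ := ∑ i, Real.log (d i) with hΛ
  rcases le_total Λ (ε * Real.log n) with h | h
  -- A part of size at most `n^ε` serves as its own change, leaving rank `0`.
  · refine (NonRigid.dense (piKron A)).mono (by positivity) (Nat.le_floor ?_)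
    rw [card_pi_fin hd, Real.exp_le_exp]
    nlinarith
  · refine (H F ι d hd hD A).mono ?_ (Nat.floor_le_floor (Real.exp_le_exp.2 (by gcongr)))
    rw [le_div_iff₀ (by positivity)]
    have h1 : 8 * Real.logb β n ≤ Real.exp (c * Λ) := by
      calc 8 * Real.logb β n = 8 / Real.log β * Real.log n := by
            rw [Real.logb]
            ring
        _ ≤ Real.exp (c * ε * Real.log n) := hn
        _ ≤ Real.exp (c * Λ) := by
            rw [Real.exp_le_exp, mul_assoc]
            gcongr
    have h2 : Real.exp Λ = Real.exp ((1 - c) * Λ) * Real.exp (c * Λ) := by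
      rw [← Real.exp_add]
      ring_nf
    rw [h2]
    nlinarith [Real.exp_pos ((1 - c) * Λ)]

/-- The square of the antitone `log x / √x`. It makes the gap decreasing in the order, so every
large factor has at least the gap belonging to the size of the whole part. -/
theorem log_sq_div_self_le {x y : ℝ} (hx : Real.exp 2 ≤ x) (hxy : x ≤ y) :
    Real.log y ^ 2 / y ≤ Real.log x ^ 2 / x := by
  have hx0 : 0 < x := (Real.exp_pos 2).trans_le hx
  have h := Real.log_div_sqrt_antitoneOn (show x ∈ {x | Real.exp 2 ≤ x} from hx)
    (show y ∈ {x | Real.exp 2 ≤ x} from hx.trans hxy) hxy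
  have hy1 : 1 ≤ y := (Real.one_le_exp (by norm_num)).trans (hx.trans hxy)
  have h0 : 0 ≤ Real.log y / √y := div_nonneg (Real.log_nonneg hy1) (Real.sqrt_nonneg _)
  have h2 := pow_le_pow_left₀ h0 h 2
  simp only [div_pow] at h2
  rwa [Real.sq_sqrt hx0.le, Real.sq_sqrt (by linarith)] at h2

theorem rigidityGap_eq {β ε : ℝ} (d : ℕ) :
    rigidityGap β ε d = 12 / (ε ^ 3 * Real.log β ^ 2) *
      (Real.log (Real.logb β d) ^ 2 / Real.logb β d) := by
  rw [rigidityGap, Real.logb.eq_1 β (Real.logb β d), div_pow]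
  simp only [div_eq_mul_inv, mul_inv]
  ring

/-- The order beyond which a factor of the family counts as large. -/
def LargeOrder (β ε : ℝ) (d : ℕ) : Prop :=
  0 < d ∧ Real.exp 2 ≤ Real.logb β d ∧ 2 ≤ Real.exp (ε * Real.log d) ∧
    Real.exp (-(rigidityGap β ε d / 2 * Real.log d)) ≤ ε / 2

theorem eventually_largeOrder {β ε : ℝ} (hβ : 1 < β) (hε : 0 < ε) :
    ∀ᶠ d : ℕ in atTop, LargeOrder β ε d := by
  have hlβ : 0 < Real.log β := Real.log_pos hβ
  have hy := tendsto_logb_natCast hβ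
  have hlog : Tendsto (fun n : ℕ => Real.log n) atTop atTop :=
    Real.tendsto_log_atTop.comp tendsto_natCast_atTop_atTop
  have h1 : Tendsto (fun d : ℕ => Real.exp (ε * Real.log d)) atTop atTop :=
    Real.tendsto_exp_atTop.comp (hlog.const_mul_atTop hε)
  have h2 : Tendsto (fun d : ℕ => Real.exp (-(6 / (ε ^ 3 * Real.log β) *
      Real.log (Real.logb β d) ^ 2))) atTop (nhds 0) := by
    refine Real.tendsto_exp_neg_atTop_nhds_zero.comp ?_
    refine Tendsto.const_mul_atTop (by positivity) ?_
    exact (tendsto_pow_atTop two_ne_zero).comp (Real.tendsto_log_atTop.comp hy)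
  filter_upwards [eventually_gt_atTop 0, hy.eventually_ge_atTop (Real.exp 2),
    h1.eventually_ge_atTop 2, h2.eventually_le_const (show 0 < ε / 2 by positivity)]
    with d hd0 hd1 hd2 hd3
  refine ⟨hd0, hd1, hd2, ?_⟩
  have hy0 : 0 < Real.logb β d := (Real.exp_pos 2).trans_le hd1
  -- The logarithm in the denominator of the gap cancels, leaving a multiple of `(log log d)²`,
  -- which tends to infinity.
  have : rigidityGap β ε d / 2 * Real.log d =
      6 / (ε ^ 3 * Real.log β) * Real.log (Real.logb β d) ^ 2 := by
    have hl : Real.log d = Real.logb β d * Real.log β := by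
      rw [Real.logb, div_mul_cancel₀ _ hlβ.ne']
    rw [rigidityGap_eq, hl]
    field_simp
    ring
  rw [this]
  exact hd3

/-- The rank saving `1 / (2 log n)` for the part of a Kronecker product with large factors. -/
theorem eventually_nonRigid_large_part {β ε : ℝ} (hβ : 1 < β) (hε : 0 < ε) :
    ∀ᶠ n : ℕ in atTop,
      ∀ (F : Type u) [Field F] (ι : Type) [Fintype ι] [DecidableEq ι] (d : ι → ℕ),
      (∀ i, LargeOrder β ε (d i)) → ∑ i, Real.log (d i) ≤ Real.log n →
      ∀ (A : ∀ i, Matrix (Fin (d i)) (Fin (d i)) F) (t : ι → ℕ),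
        (∀ i, NonRigid (A i) ((d i : ℝ) ^ (1 - rigidityGap β ε (d i))) (t i)) →
        (∀ i, (t i : ℝ) ≤ (d i : ℝ) ^ ε) →
        NonRigid (piKron A) (Real.exp (∑ i, Real.log (d i)) / (2 * Real.logb β n))
          ⌊Real.exp (3 * ε * Real.log n)⌋₊ := by
  have hlβ : 0 < Real.log β := Real.log_pos hβ
  have hy := tendsto_logb_natCast hβ
  have hlog : Tendsto (fun n : ℕ => Real.log n) atTop atTop :=
    Real.tendsto_log_atTop.comp tendsto_natCast_atTop_atTop
  set C : ℝ := 3 / (ε ^ 2 * Real.log β) with hC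
  have hC0 : 0 < C := by positivity
  -- With `v = log (ε logb β n)` the left side is `log (2 logb β n)`, the saving required; the
  -- saving available is quadratic in `v`.
  have hev : ∀ᶠ v : ℝ in atTop, v + (Real.log 2 - Real.log ε) ≤ C * v ^ 2 := by
    have h1 : Tendsto (fun v : ℝ => v * (C * v + -1)) atTop atTop :=
      tendsto_id.atTop_mul_atTop₀
        (tendsto_atTop_add_const_right _ _ (tendsto_id.const_mul_atTop hC0))
    filter_upwards [h1.eventually_ge_atTop (Real.log 2 - Real.log ε)] with v hv
    nlinarith
  have hεy : Tendsto (fun n : ℕ => ε * Real.logb β n) atTop atTop := hy.const_mul_atTop hε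
  filter_upwards [(Real.tendsto_log_atTop.comp hεy).eventually hev, hy.eventually_gt_atTop 0,
    hεy.eventually_ge_atTop 1, hlog.eventually_gt_atTop 0]
    with n hn hn0 hn1 hn2 F _ ι _ _ d hd hle A t hA ht
  have hd0 : ∀ i, 0 < d i := fun i => (hd i).1
  set Λ := ∑ i, Real.log (d i) with hΛ
  rcases le_total Λ (ε * Real.log n) with h | h
  · refine (NonRigid.dense (piKron A)).mono (by positivity) (Nat.le_floor ?_)
    rw [card_pi_fin hd0, Real.exp_le_exp]
    nlinarith
  set Y := Λ / Real.log β with hY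
  have hYn : ε * Real.logb β n ≤ Y := by
    rw [hY, Real.logb, ← mul_div_assoc]
    gcongr
  have hY1 : 1 ≤ Y := hn1.trans hYn
  have hY0 : 0 < Y := by linarith
  -- Half of the gap at order `exp Λ`. The other half of each factor's gap pays for the `ε / 2` in
  -- the last clause of `LargeOrder`.
  set s : ℝ := 12 / (ε ^ 3 * Real.log β ^ 2) * (Real.log Y ^ 2 / Y) / 2 with hs
  have hs0 : 0 ≤ s := by positivity
  have hsγ : ∀ i, s ≤ rigidityGap β ε (d i) / 2 := by
    intro i
    rw [hs, rigidityGap_eq]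
    gcongr ?_ / 2
    gcongr ?_ * ?_
    refine log_sq_div_self_le (hd i).2.1 ?_
    rw [hY, Real.logb]
    gcongr
    exact Finset.single_le_sum (f := fun i => Real.log (d i))
      (fun i _ => Real.log_natCast_nonneg _) (Finset.mem_univ i)
  refine (NonRigid.piKron_of_small_rank hd0 A (ε := ε) hs0 _ t hA (fun i => ?_)
    fun i => ?_).mono ?_ ?_
  · have h0 : (0 : ℝ) < d i := by exact_mod_cast hd0 i
    have hl : 0 ≤ Real.log (d i) := Real.log_natCast_nonneg _
    refine le_trans ?_ (mul_le_mul_of_nonneg_left (hd i).2.2.2 h0.le)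
    have hexp (w : ℝ) : (d i : ℝ) * Real.exp w = Real.exp (Real.log (d i) + w) := by
      rw [Real.exp_add, Real.exp_log h0]
    rw [hexp, Real.rpow_def_of_pos h0, ← Real.exp_add, Real.exp_le_exp]
    nlinarith [hsγ i]
  · have h0 : (0 : ℝ) < d i := by exact_mod_cast hd0 i
    have h1 := ht i
    rw [Real.rpow_def_of_pos h0, mul_comm] at h1
    have h2 := (hd i).2.2.1
    have h3 : Real.exp (2 * ε * Real.log (d i)) = Real.exp (ε * Real.log (d i)) ^ 2 := by
      rw [← Real.exp_nat_mul]
      push_cast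
      ring_nf
    rw [h3]
    nlinarith
  · rw [le_div_iff₀ (by positivity)]
    have hsΛ : s * (ε / 2) * Λ = C * Real.log Y ^ 2 := by
      have hl : Λ = Y * Real.log β := by rw [hY, div_mul_cancel₀ _ hlβ.ne']
      rw [hs, hC, hl]
      field_simp
      ring
    have hlogY : Real.log (ε * Real.logb β n) ≤ Real.log Y :=
      Real.log_le_log (by linarith) hYn
    have hlog0 : 0 ≤ Real.log (ε * Real.logb β n) := Real.log_nonneg hn1
    have h1 : 2 * Real.logb β n ≤ Real.exp (s * (ε / 2) * Λ) := by
      rw [hsΛ]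
      have h2 : Real.log (2 * Real.logb β n) ≤ C * Real.log Y ^ 2 := by
        have h3 : Real.log (ε * Real.logb β n) = Real.log ε + Real.log (Real.logb β n) :=
          Real.log_mul hε.ne' hn0.ne'
        rw [Real.log_mul two_ne_zero hn0.ne']
        calc _ = Real.log (ε * Real.logb β n) + (Real.log 2 - Real.log ε) := by
              rw [h3]
              ring
          _ ≤ C * Real.log (ε * Real.logb β n) ^ 2 := hn
          _ ≤ C * Real.log Y ^ 2 := by gcongr
      calc 2 * Real.logb β n = Real.exp (Real.log (2 * Real.logb β n)) :=
            (Real.exp_log (by positivity)).symm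
        _ ≤ _ := Real.exp_le_exp.2 h2
    calc _ ≤ Real.exp ((1 - s * (ε / 2)) * Λ) * Real.exp (s * (ε / 2) * Λ) := by gcongr
      _ = Real.exp Λ := by
        rw [← Real.exp_add]
        ring_nf
  · exact Nat.floor_le_floor (Real.exp_le_exp.2 (by gcongr))

/-! ### Combining the two parts -/

/-- The Kronecker product over all indices is that over the indices with `p`, times the rest. -/
theorem NonRigid.piKron_of_subtypes {F ι : Type*} [Field F] [Fintype ι] [DecidableEq ι]
    {d : ι → ℕ} (A : ∀ i, Matrix (Fin (d i)) (Fin (d i)) F) (p : ι → Prop) [DecidablePred p]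
    {r₁ r₂ : ℝ} {t₁ t₂ : ℕ}
    (h₁ : NonRigid (piKron fun i : {i // p i} => A i) r₁ t₁)
    (h₂ : NonRigid (piKron fun i : {i // ¬ p i} => A i) r₂ t₂) :
    NonRigid (piKron A)
      (r₁ * Fintype.card (∀ i : {i // ¬ p i}, Fin (d i)) +
        Fintype.card (∀ i : {i // p i}, Fin (d i)) * r₂) (t₁ * t₂) := by
  set e := (Equiv.piEquivPiSubtypeProd p fun i => Fin (d i)).symm with he
  refine NonRigid.of_submatrix e e ?_
  have h : (piKron A).submatrix e e = Matrix.kroneckerMap (· * ·)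
      (piKron fun i : {i // p i} => A i) (piKron fun i : {i // ¬ p i} => A i) := by
    ext ⟨x, x'⟩ ⟨y, y'⟩
    rw [Matrix.submatrix_apply, piKron_apply, Matrix.kroneckerMap_apply, piKron_apply,
      piKron_apply, ← Fintype.prod_subtype_mul_prod_subtype p]
    congr 1
    · refine Finset.prod_congr rfl fun i _ => ?_
      simp [he, Equiv.piEquivPiSubtypeProd, i.2]
    · refine Finset.prod_congr rfl fun i _ => ?_
      simp [he, Equiv.piEquivPiSubtypeProd, i.2]
  rw [h]
  exact h₁.kronecker h₂

theorem theorem6p1 (β ε b : ℝ) (hβ : β = 2 ∨ β = Real.exp 1)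
    (hε₀ : 0 < ε) (hε : ε < 1 / 2) (hb : 2 ≤ b) :
    ∃ N : ℕ, ∀ (F : Type*) [Field F] (𝓕 : ∀ d : ℕ, Set (Matrix (Fin d) (Fin d) F)),
      IsBoundedOrNonRigid β ε b 𝓕 →
      ∀ (k : ℕ) (d : Fin k → ℕ) (M : ∀ i, Matrix (Fin (d i)) (Fin (d i)) F),
        (∀ i, M i ∈ 𝓕 (d i)) →
        ∀ n : ℕ, n = ∏ i, d i →
          (rcRigidity (kroneckerProd M) ((n : ℝ) / Real.logb β n) : ℝ) ≤ (n : ℝ) ^ (6 * ε) ∨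
            n ≤ N := by
  have hβ1 : 1 < β := by
    rcases hβ with rfl | rfl
    · norm_num
    · exact Real.one_lt_exp_iff.2 one_pos
  have hε1 : ε ≤ 1 := by linarith
  obtain ⟨D₀, hD₀⟩ := eventually_atTop.1 (eventually_largeOrder hβ1 hε₀)
  -- Factors of order above `D` satisfy `LargeOrder` and, having order above `b`, must be non-rigid.
  set D := max D₀ ⌈b⌉₊ with hD
  obtain ⟨N, hN⟩ := eventually_atTop.1 (((eventually_nonRigid_bounded_part hβ1 hε₀ hε1 D).and
    (eventually_nonRigid_large_part hβ1 hε₀)).and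
      ((tendsto_logb_natCast hβ1).eventually_gt_atTop 0))
  refine ⟨N, fun F _ 𝓕 h𝓕 k d M hM n hn => ?_⟩
  by_cases hnN : n ≤ N
  · exact Or.inr hnN
  left
  obtain ⟨⟨hbdd, hlarge⟩, hy⟩ := hN n (not_le.1 hnN).le
  have hn0 : 0 < n := (Nat.zero_le N).trans_lt (not_le.1 hnN)
  have hn0' : (0 : ℝ) < n := by exact_mod_cast hn0
  have hd : ∀ i, 0 < d i := by
    intro i
    refine Nat.pos_of_ne_zero fun h => hn0.ne' ?_
    rw [hn]
    exact Finset.prod_eq_zero (Finset.mem_univ i) h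
  set p : Fin k → Prop := fun i => d i ≤ D with hp
  set Λ₁ := ∑ i : {i // p i}, Real.log (d i) with hΛ₁
  set Λ₂ := ∑ i : {i // ¬ p i}, Real.log (d i) with hΛ₂
  have hsum : Λ₁ + Λ₂ = Real.log n := by
    rw [hΛ₁, hΛ₂, Fintype.sum_subtype_add_sum_subtype p fun i => Real.log (d i),
      sum_log_eq_log_prod hd, ← hn]
  have hΛ₁0 : 0 ≤ Λ₁ := Finset.sum_nonneg fun i _ => Real.log_natCast_nonneg _
  have hΛ₂0 : 0 ≤ Λ₂ := Finset.sum_nonneg fun i _ => Real.log_natCast_nonneg _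
  have h₁ := hbdd F {i // p i} (fun i => d i) (fun i => hd i) (fun i => i.2)
    (by linarith) fun i => M i
  have hfac : ∀ i : {i // ¬ p i}, ∃ t : ℕ,
      NonRigid (M i) ((d i : ℝ) ^ (1 - rigidityGap β ε (d i))) t ∧ (t : ℝ) ≤ (d i : ℝ) ^ ε := by
    intro i
    have hi : D < d i := not_le.1 i.2
    rcases h𝓕 (d i) (M i) (hM i) with h | h
    · have h1 : (D : ℝ) < d i := by exact_mod_cast hi
      have h2 : (⌈b⌉₊ : ℝ) ≤ D := by exact_mod_cast le_max_right D₀ ⌈b⌉₊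
      linarith [Nat.le_ceil b]
    · exact ⟨_, (rcRigidity_le_iff (M i) (by positivity) _).1 le_rfl, h⟩
  choose t ht ht' using hfac
  have h₂ := hlarge F {i // ¬ p i} (fun i => d i)
    (fun i => hD₀ _ ((le_max_left _ _).trans (not_le.1 i.2).le)) (by linarith)
    (fun i => M i) t ht ht'
  have h := NonRigid.piKron_of_subtypes M p h₁ h₂
  rw [card_pi_fin fun i : {i // p i} => hd i, card_pi_fin fun i : {i // ¬ p i} => hd i] at h
  have hexp : Real.exp Λ₁ * Real.exp Λ₂ = n := by
    rw [← Real.exp_add, hsum, Real.exp_log hn0']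
  -- Each of the two rank terms equals `n / (2 logb β n)`. The sparsity is at most `n^(5ε)`, within
  -- the required `n^(6ε)`.
  have h' := h.mono (r' := (n : ℝ) / Real.logb β n) (le_of_eq ?_) le_rfl
  · have hle := (rcRigidity_le_iff (kroneckerProd M) (by positivity) _).2 h'
    refine (Nat.cast_le.2 hle).trans ?_
    have hlog : 0 ≤ Real.log n := Real.log_natCast_nonneg _
    rw [Nat.cast_mul, Real.rpow_def_of_pos hn0']
    calc _ ≤ Real.exp (2 * ε * Real.log n) * Real.exp (3 * ε * Real.log n) := by
          gcongr <;> exact Nat.floor_le (Real.exp_pos _).le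
      _ ≤ _ := by
          rw [← Real.exp_add, Real.exp_le_exp]
          nlinarith
  · change Real.exp Λ₁ / (2 * Real.logb β n) * Real.exp Λ₂ +
      Real.exp Λ₁ * (Real.exp Λ₂ / (2 * Real.logb β n)) = _
    rw [← mul_div_assoc, div_mul_eq_mul_div, hexp]
    field_simp
    norm_num
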